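/- All rings are commutative with identity, and subrings share the identity. For a ring extension $R\subseteq S$, let $[R,S]$ denote the set of rings $U$ with $R\subseteq U\subseteq S$. The extension $R\subseteq S$ is called Prüfer if for every $U\in[R,S]$ the inclusion $R\to U$ is a flat epimorphism (that is, $U$ is a flat $R$-module and $R\to U$ is an epimorphism in the category of commutative rings). The extension $R\subseteq S$ is called quasi-Prüfer if $R'\subseteq S$ is Prüfer, where $R'$ is the integral closure of $R$ in $S$. Corollary 3.3. Let $R\subseteq T\subseteq S$ be a tower of ring extensions, and let $\overline R$ be the integral closure of $R$ in $S$. Then: (1) $R\subseteq S$ is quasi-Prüfer if and only if both $R\subseteq T$ and $T\subseteq S$ are quasi-Prüfer. (2) $R\subseteq T$ is quasi-Prüfer if and only if $R\subseteq \overline R\,T$ is quasi-Prüfer, where $\overline R\,T$ is the subring of $S$ generated by $\overline R\cup T$. -/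

import Mathlib

/-- `R → S` is a flat epimorphism of commutative rings: `S` is flat over `R`, and `R → S` is an
epimorphism in the category of commutative rings (equivalently, `S ⊗[R] S → S` is injective,
which is Mathlib's `Algebra.IsEpi`). -/
structure IsFlatEpimorphism (R S : Type*) [CommRing R] [CommRing S] [Algebra R S] : Prop where
  flat : Module.Flat R S
  epi : Algebra.IsEpi R S

/-- A ring extension `R ⊆ S` is Prüfer if `R ⊆ T` is a flat epimorphism for every
intermediate ring `T ∈ [R, S]`. (Used for injective `algebraMap R S` only.) -/
def IsPruferExtension (R S : Type*) [CommRing R] [CommRing S] [Algebra R S] : Prop :=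
  ∀ T : Subalgebra R S, IsFlatEpimorphism R T

/-- A ring extension `R ⊆ S` is quasi-Prüfer if `R' ⊆ S` is a Prüfer extension, where `R'` is
the integral closure of `R` in `S`. (Used for injective `algebraMap R S` only.) -/
def IsQuasiPruferExtension (R S : Type*) [CommRing R] [CommRing S] [Algebra R S] : Prop :=
  IsPruferExtension (integralClosure R S) S

/-!
The proof replaces quasi-Prüfer extensions by a condition on polynomials. Call `R → S` *primitive*
if every `s : S` satisfies, for every prime `p` of `R`, some `f ∈ R[X]` not in `p R[X]`. This is
equivalent to being quasi-Prüfer (`isQuasiPruferExtension_iff_isPrimitiveExtension`). It passes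
to the two halves of a tower for trivial reasons, it holds for integral extensions, and it is
transitive (`IsPrimitiveExtension.trans`); both claims follow, the second one because the
compositum of `T` with the integral closure of `R` is integral over `T`.

Transitivity is proved with valuations. If `s` violates the condition at `p`, then the kernel of
`R[X] → S`, `X ↦ s`, lies in `p R[X]`. A minimal prime of that kernel below `p R[X]` lifts to a
prime `P` of `S`, and some valuation ring `V` of `Frac (S / P)` dominates the image of `R[X]`
localized at `p R[X]`, so that `s` has a residue which is transcendental over the image of `R`
(`IsPrimitiveExtension.of_isAlgebraic_residue`). For a tower of primitive extensions
`R → T → S` this is impossible: normalized by its largest coefficient, a relation for `s` over `T`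
reduces to a nonzero relation whose coefficients are residues of quotients `t / u` with `t`, `u`
in `T` and `u` of value at least `1`. Such residues are algebraic over the image of `R`, as `u` has
a multiple in `T` of value exactly `1` (`IsPrimitiveExtension.exists_valuation_mul_eq_one`).

The link with flat epimorphisms is that `A ⊆ U` is a flat epimorphism as soon as
`(A :_A u) U = U` for all `u` in `U`, and that the converse holds. If `A` is integrally closed
in `U` and `f(u) = 0`, the coefficients of `f` lie in `(A :_A u) U`, because `a u` belongs to `A`
for the leading coefficient `a`, which allows one to lower the degree
(`algebraMap_coeff_mem_map_denominatorIdeal`). So primitive integrally closed extensions are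
Prüfer. Conversely, `(A :_A s) A[s] = A[s]` yields polynomials that kill `s` and do not all lie in
`p A[X]`.
-/

open Polynomial IsLocalRing TensorProduct

/-! ### Elements algebraic over the image of a ring homomorphism -/

/-- `x` is a zero of a polynomial over `R` that does not vanish in `K[X]`; equivalently, `x` is
algebraic over the image of `f`. The homomorphism `f` need not be injective. -/
def RingHom.IsAlgebraicElem {R K : Type*} [CommRing R] [Field K] (f : R →+* K) (x : K) : Prop :=
  ∃ g : R[X], g.map f ≠ 0 ∧ g.eval₂ f x = 0

namespace RingHom.IsAlgebraicElem

variable {R K : Type*} [CommRing R] [Field K] {f : R →+* K} {x y : K}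

theorem iff_isAlgebraic_range : f.IsAlgebraicElem x ↔ IsAlgebraic f.range x := by
  have hf : f = (algebraMap f.range K).comp f.rangeRestrict := rfl
  have hinj : Function.Injective (algebraMap f.range K) := Subtype.val_injective
  constructor
  · rintro ⟨g, hg0, hg⟩
    refine ⟨g.map f.rangeRestrict, fun h0 ↦ hg0 ?_, ?_⟩
    · rw [hf, ← Polynomial.map_map, h0, Polynomial.map_zero]
    · rw [aeval_def, eval₂_map]; exact hg
  · rintro ⟨g, hg0, hg⟩
    obtain ⟨g, rfl⟩ := map_surjective _ f.rangeRestrict_surjective g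
    refine ⟨g, fun h0 ↦ hg0 ?_, ?_⟩
    · rw [hf, ← Polynomial.map_map] at h0
      exact (Polynomial.map_eq_zero_iff hinj).mp h0
    · rw [aeval_def, eval₂_map] at hg; exact hg

theorem div (hx : f.IsAlgebraicElem x) (hy : f.IsAlgebraicElem y) :
    f.IsAlgebraicElem (x / y) := by
  rw [iff_isAlgebraic_range] at *
  rw [div_eq_mul_inv]
  exact hx.mul hy.inv

/-- A zero of a nonzero polynomial with algebraic coefficients is algebraic. The zero and the
coefficients are given as images under `π`, and the relation may be checked before applying `π`. -/
theorem of_sum_eq_zero {V : Type*} [CommRing V] (π : V →+* K) {y : V} {s : Finset ℕ} {z : ℕ → V}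
    (hz : ∀ k, f.IsAlgebraicElem (π (z k))) {j : ℕ} (hj : j ∈ s) (hj0 : π (z j) ≠ 0)
    (h : ∑ k ∈ s, z k * y ^ k = 0) : f.IsAlgebraicElem (π y) := by
  simp only [iff_isAlgebraic_range] at *
  let A := Subalgebra.algebraicClosure f.range K
  have hy : IsAlgebraic A (π y) := by
    refine ⟨∑ k ∈ s, monomial k (⟨π (z k), hz k⟩ : A), fun h0 ↦ hj0 ?_, ?_⟩
    · have := congrArg (fun f ↦ (f.coeff j : K)) h0
      simpa only [finsetSum_coeff, coeff_monomial, Finset.sum_ite_eq', hj, if_true, coeff_zero,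
        ZeroMemClass.coe_zero] using this
    · rw [map_sum, ← map_zero π, ← h, map_sum]
      exact Finset.sum_congr rfl fun k _ ↦ by rw [aeval_monomial, map_mul, map_pow]; rfl
  exact hy.restrictScalars _

end RingHom.IsAlgebraicElem

/-! ### Primitive extensions -/

/-- Every element of `S` is, for every prime `p` of `R`, a zero of a polynomial over `R` not all of
whose coefficients lie in `p`. The polynomial may depend on `p`; this is equivalent to the existence
of one polynomial whose coefficients generate the unit ideal of `R`. -/
def IsPrimitiveExtension (R S : Type*) [CommRing R] [CommRing S] [Algebra R S] : Prop :=
  ∀ (s : S) (p : Ideal R), p.IsPrime → ∃ f : R[X], aeval s f = 0 ∧ ∃ i, f.coeff i ∉ p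

namespace IsPrimitiveExtension

section Tower

variable {R T S : Type*} [CommRing R] [CommRing T] [CommRing S]
  [Algebra R T] [Algebra T S] [Algebra R S] [IsScalarTower R T S]

theorem bot_of_injective (hTS : Function.Injective (algebraMap T S))
    (h : IsPrimitiveExtension R S) : IsPrimitiveExtension R T := by
  intro t p hp
  obtain ⟨f, hf, hi⟩ := h (algebraMap T S t) p hp
  exact ⟨f, hTS (by rw [← aeval_algebraMap_apply, hf, map_zero]), hi⟩

theorem top (h : IsPrimitiveExtension R S) : IsPrimitiveExtension T S := by
  intro s q hq
  obtain ⟨f, hf, i, hi⟩ := h s (q.comap (algebraMap R T)) inferInstance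
  exact ⟨f.map (algebraMap R T), by rwa [aeval_map_algebraMap], i, by rwa [coeff_map]⟩

end Tower

theorem of_isIntegral {R S : Type*} [CommRing R] [CommRing S] [Algebra R S]
    [Algebra.IsIntegral R S] : IsPrimitiveExtension R S := by
  intro s p hp
  obtain ⟨f, hf, hs⟩ := Algebra.IsIntegral.isIntegral (R := R) s
  exact ⟨f, hs, f.natDegree, by rw [hf.coeff_natDegree]; exact hp.one_notMem⟩

/-! ### Residues of the elements of a primitive extension -/

section Valuation

variable {R S L : Type*} [CommRing R] [CommRing S] [Algebra R S] [Field L]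
  {V : ValuationSubring L} {φ : S →+* L} {ρ : R →+* V}

/-- Elements of `S` with image in `V` have a residue algebraic over `R`: the polynomial supplied for
the centre of `V` on `R` does not vanish modulo the maximal ideal of `V`. -/
theorem isAlgebraic_residue (h : IsPrimitiveExtension R S)
    (hρ : ∀ r, (ρ r : L) = φ (algebraMap R S r)) {s : S} {y : V} (hy : (y : L) = φ s) :
    ((residue V).comp ρ).IsAlgebraicElem (residue V y) := by
  obtain ⟨f, hf, i, hi⟩ := h s (RingHom.ker ((residue V).comp ρ)) (RingHom.ker_isPrime _)
  refine ⟨f, fun h0 ↦ hi ?_, ?_⟩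
  · rw [RingHom.mem_ker, ← coeff_map, h0, coeff_zero]
  · have hV : eval₂ ρ y f = 0 := by
      apply Subtype.val_injective
      have h1 := hom_eval₂ f ρ V.subtype y
      have h2 := hom_eval₂ f (algebraMap R S) φ s
      have h3 : V.subtype.comp ρ = φ.comp (algebraMap R S) := RingHom.ext hρ
      rw [← aeval_def, hf, map_zero] at h2
      rw [h3, show V.subtype y = φ s from hy, ← h2] at h1
      simpa using h1
    rw [← hom_eval₂, hV, map_zero]

/-- An element `u` of `S` of value greater than `1` can be scaled within `S` to value `1`. The factor
is a Horner quotient `(f(X) div X ^ (i + 1))(u)` of a relation `f(u) = 0` over `R` whose `i`-th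
coefficient is a unit of `V`. -/
theorem exists_valuation_mul_eq_one (h : IsPrimitiveExtension R S)
    (hρ : ∀ r, (ρ r : L) = φ (algebraMap R S r)) {u : S} (hu : 1 < V.valuation (φ u)) :
    ∃ b : S, V.valuation (φ (b * u)) = 1 := by
  obtain ⟨f, hf, i, hi⟩ := h u (RingHom.ker ((residue V).comp ρ)) (RingHom.ker_isPrime _)
  have hcoeff (k : ℕ) : V.valuation (φ (algebraMap R S (f.coeff k))) ≤ 1 := by
    rw [← hρ]; exact V.valuation_le_one _
  have hunit : V.valuation (φ (algebraMap R S (f.coeff i))) = 1 := by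
    rw [← hρ, ← V.valuation_eq_one_iff]
    rw [RingHom.mem_ker, RingHom.comp_apply] at hi
    exact (residue_ne_zero_iff_isUnit _).mp hi
  refine ⟨∑ x ∈ Finset.range (f.natDegree + 1),
    algebraMap R S (f.coeff (i + 1 + x)) * u ^ x, ?_⟩
  set b := ∑ x ∈ Finset.range (f.natDegree + 1),
    algebraMap R S (f.coeff (i + 1 + x)) * u ^ x with hb
  have hu0 : V.valuation (φ u) ≠ 0 := (zero_lt_one.trans hu).ne'
  -- Multiplying `b * u` by `u ^ i` gives the part of `f(u)` of degree above `i`, which is minus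
  -- the part of degree at most `i`; there the term of degree `i` dominates.
  have hsum : (∑ x ∈ Finset.range i, algebraMap R S (f.coeff x) * u ^ x +
      algebraMap R S (f.coeff i) * u ^ i) + b * u * u ^ i = 0 := by
    rw [aeval_eq_sum_range' (n := i + 1 + (f.natDegree + 1)) (by omega),
      Finset.sum_range_add, Finset.sum_range_succ _ i] at hf
    rw [← hf, hb, mul_assoc, Finset.sum_mul]
    simp only [Algebra.smul_def]
    congr 1
    exact Finset.sum_congr rfl fun x _ ↦ by ring
  have hlow : V.valuation (φ (∑ x ∈ Finset.range i, algebraMap R S (f.coeff x) * u ^ x)) <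
      V.valuation (φ (algebraMap R S (f.coeff i) * u ^ i)) := by
    rw [map_sum]
    refine Valuation.map_sum_lt _ ?_ fun x hx ↦ ?_
    · rw [map_mul, map_mul, hunit, one_mul, map_pow, map_pow]
      exact pow_ne_zero _ hu0
    · simp only [map_mul, map_pow, hunit, one_mul]
      calc _ ≤ 1 * V.valuation (φ u) ^ x := by gcongr; exact hcoeff x
        _ < _ := by rw [one_mul]; exact pow_lt_pow_right₀ hu (Finset.mem_range.mp hx)
  have h1 := congrArg φ (eq_neg_of_add_eq_zero_right hsum)
  have h2 := congrArg V.valuation h1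
  rw [map_neg, Valuation.map_neg, map_add φ, Valuation.map_add_eq_of_lt_right _ hlow] at h2
  rw [map_mul φ, map_mul φ (algebraMap R S _), map_mul V.valuation, map_mul V.valuation, hunit,
    map_pow, map_pow, one_mul] at h2
  exact mul_right_cancel₀ (pow_ne_zero i hu0) (h2.trans (one_mul _).symm)

/-- The residue of a quotient `y = t / u` of elements of `S` is algebraic over `R` when `u` has value
at least `1`, although `t` and `u` themselves need not map into `V`. -/
theorem isAlgebraic_residue_of_mul_eq (h : IsPrimitiveExtension R S)
    (hρ : ∀ r, (ρ r : L) = φ (algebraMap R S r)) {t u : S} {y : V}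
    (hu : 1 ≤ V.valuation (φ u)) (hy : (y : L) * φ u = φ t) :
    ((residue V).comp ρ).IsAlgebraicElem (residue V y) := by
  obtain ⟨b, hb⟩ : ∃ b : S, V.valuation (φ (b * u)) = 1 := by
    rcases hu.eq_or_lt with hu | hu
    · exact ⟨1, by rw [one_mul, ← hu]⟩
    · exact h.exists_valuation_mul_eq_one hρ hu
  let w : V := ⟨φ (b * u), (V.valuation_le_one_iff _).mp hb.le⟩
  have hw : ((residue V).comp ρ).IsAlgebraicElem (residue V w) :=
    h.isAlgebraic_residue hρ (s := b * u) rfl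
  have hyw : ((residue V).comp ρ).IsAlgebraicElem (residue V (y * w)) := by
    refine h.isAlgebraic_residue hρ (s := b * t) ?_
    change (y : L) * φ (b * u) = _
    rw [map_mul, map_mul, ← hy]; ring
  have hw0 : residue V w ≠ 0 := by
    rw [residue_ne_zero_iff_isUnit, V.valuation_eq_one_iff]; exact hb
  have := hyw.div hw
  rwa [map_mul, mul_div_cancel_right₀ _ hw0] at this

end Valuation

/-! ### Transitivity -/

/-- Valuative criterion for primitive extensions. -/
theorem of_isAlgebraic_residue {R : Type*} {S : Type*} [CommRing R] [CommRing S] [Algebra R S]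
    (h : ∀ (P : Ideal S) [P.IsPrime] (V : ValuationSubring (FractionRing (S ⧸ P)))
      (φ : S →+* FractionRing (S ⧸ P)) (ρ : R →+* V),
      (∀ r, (ρ r : FractionRing (S ⧸ P)) = φ (algebraMap R S r)) →
      ∀ (s : S) (y : V), (y : FractionRing (S ⧸ P)) = φ s →
        ((residue V).comp ρ).IsAlgebraicElem (residue V y)) :
    IsPrimitiveExtension R S := by
  intro s p hp
  by_contra! hker
  let Q : Ideal R[X] := p.map C
  have hQ : Q.IsPrime := Ideal.isPrime_map_C_of_isPrime
  have hkerQ : (⊥ : Ideal S).comap (aeval s : R[X] →ₐ[R] S).toRingHom ≤ Q := fun f hf ↦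
    Ideal.mem_map_C_iff.mpr (hker f hf)
  obtain ⟨Q₀, hQ₀, hQ₀Q⟩ := Ideal.exists_minimalPrimes_le hkerQ
  obtain ⟨P, hP, -, hPQ₀⟩ := Ideal.exists_comap_eq_of_mem_minimalPrimes _ Q₀ hQ₀
  let φ : S →+* FractionRing (S ⧸ P) := (algebraMap (S ⧸ P) _).comp (Ideal.Quotient.mk P)
  let ψ : R[X] →+* FractionRing (S ⧸ P) := φ.comp (aeval s : R[X] →ₐ[R] S).toRingHom
  have hψ (f : Q.primeCompl) : IsUnit (ψ f) := by
    refine isUnit_iff_ne_zero.mpr fun h0 ↦ f.2 (hQ₀Q ?_)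
    rw [← hPQ₀, Ideal.mem_comap]
    have h1 : Ideal.Quotient.mk P (aeval s (f : R[X])) = 0 :=
      IsFractionRing.injective (S ⧸ P) (FractionRing (S ⧸ P)) (h0.trans (map_zero _).symm)
    exact Ideal.Quotient.eq_zero_iff_mem.mp h1
  -- `V` dominates the image of `R[X]` localized at `Q`, so the residue of `f(s)` vanishes exactly
  -- for `f` in `Q = p R[X]`, and the residue of `s` is transcendental over the image of `R`.
  let ℓ : Localization.AtPrime Q →+* FractionRing (S ⧸ P) :=
    IsLocalization.lift (M := Q.primeCompl) hψ
  obtain ⟨V, hV, hloc⟩ := IsLocalRing.exists_factor_valuationRing ℓ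
  let θ : R[X] →+* V := (ℓ.codRestrict V.toSubring hV).comp (algebraMap R[X] _)
  have hθ (f : R[X]) : (θ f : FractionRing (S ⧸ P)) = ψ f :=
    IsLocalization.lift_eq hψ f
  have hunit (f : R[X]) : residue V (θ f) = 0 ↔ f ∈ Q := by
    rw [residue_eq_zero_iff, mem_maximalIdeal, mem_nonunits_iff, not_iff_comm]
    refine (IsLocalization.AtPrime.isUnit_to_map_iff (Localization.AtPrime Q) Q f).symm.trans ?_
    exact (isUnit_map_iff (ℓ.codRestrict V.toSubring hV) _).symm
  obtain ⟨g, hg0, hg⟩ := h P V φ (θ.comp C) (fun r ↦ by simp [hθ, ψ]) s (θ X)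
    (by simp [hθ, ψ])
  refine hg0 ?_
  have hg' : residue V (θ g) = 0 := by
    have h1 := hom_eval₂ g C ((residue V).comp θ) X
    rw [eval₂_C_X] at h1
    exact h1.trans hg
  have hgp := Ideal.mem_map_C_iff.mp ((hunit g).mp hg')
  ext i
  have : residue V (θ (C (g.coeff i))) = 0 :=
    (hunit _).mpr (Ideal.mem_map_of_mem C (hgp i))
  rw [coeff_map, coeff_zero]
  exact this

theorem trans {R T S : Type*} [CommRing R] [CommRing T] [CommRing S]
    [Algebra R T] [Algebra T S] [Algebra R S] [IsScalarTower R T S]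
    (hRT : IsPrimitiveExtension R T) (hTS : IsPrimitiveExtension T S) :
    IsPrimitiveExtension R S := by
  refine of_isAlgebraic_residue fun P _ V φ ρ hρ s y hy ↦ ?_
  let ψ : T →+* FractionRing (S ⧸ P) := φ.comp (algebraMap T S)
  have hψ (r : R) : (ρ r : FractionRing (S ⧸ P)) = ψ (algebraMap R T r) := by
    rw [hρ, IsScalarTower.algebraMap_apply R T S]; rfl
  let v := V.valuation
  -- The elements of `T` all of whose `T`-multiples have value less than `1` form a prime `q`. A
  -- relation for `s` with a coefficient outside `q` has a multiple with a coefficient of value at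
  -- least `1`.
  let q : Ideal T :=
    { carrier := {x | ∀ c, v (ψ (c * x)) < 1}
      add_mem' := fun {a b} ha hb c ↦ by
        rw [mul_add, map_add]; exact v.map_add_lt (ha c) (hb c)
      zero_mem' := fun c ↦ by simp
      smul_mem' := fun a x hx c ↦ by
        rw [smul_eq_mul, ← mul_assoc]; exact hx _ }
  have hq : q.IsPrime := by
    refine Ideal.isPrime_iff.mpr ⟨fun h1 ↦ ?_, fun {a b} hab ↦ ?_⟩
    · have : (1 : T) ∈ q := h1 ▸ Submodule.mem_top
      simpa using this 1
    · by_contra! hc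
      have ha : ¬ ∀ c, v (ψ (c * a)) < 1 := hc.1
      have hb : ¬ ∀ c, v (ψ (c * b)) < 1 := hc.2
      push Not at ha hb
      obtain ⟨c, hc⟩ := ha
      obtain ⟨d, hd⟩ := hb
      refine (hab (c * d)).not_ge ?_
      rw [mul_mul_mul_comm, map_mul, map_mul]
      exact one_le_mul hc hd
  obtain ⟨g, hg, i, hi⟩ := hTS s q hq
  have hi' : ¬ ∀ c, v (ψ (c * g.coeff i)) < 1 := hi
  push Not at hi'
  obtain ⟨c, hc⟩ := hi'
  have hi0 : i ∈ g.support := by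
    rw [mem_support_iff]; intro h0; simp [h0] at hc
  obtain ⟨j, hj, hmax⟩ := g.support.exists_max_image (fun k ↦ v (ψ (c * g.coeff k))) ⟨i, hi0⟩
  have hj1 : 1 ≤ v (ψ (c * g.coeff j)) := hc.trans (hmax i hi0)
  have hj0 : ψ (c * g.coeff j) ≠ 0 := by
    intro h0; rw [h0, map_zero] at hj1; exact absurd hj1 (by simp)
  have hquot (k : ℕ) : ψ (c * g.coeff k) / ψ (c * g.coeff j) ∈ V := by
    by_cases hk : k ∈ g.support
    · rw [← V.valuation_le_one_iff, map_div₀]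
      exact div_le_one_of_le₀ (hmax k hk) zero_le
    · rw [notMem_support_iff.mp hk]; simp
  let z (k : ℕ) : V := ⟨_, hquot k⟩
  have hz (k : ℕ) : ((residue V).comp ρ).IsAlgebraicElem (residue V (z k)) :=
    hRT.isAlgebraic_residue_of_mul_eq hψ (t := c * g.coeff k) hj1 (div_mul_cancel₀ _ hj0)
  have hzj : z j = 1 := Subtype.ext (div_self hj0)
  have hzy : ∑ k ∈ g.support, z k * y ^ k = 0 := by
    apply Subtype.val_injective
    have h1 : ∑ k ∈ g.support, ψ (g.coeff k) * φ s ^ k = 0 := by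
      rw [aeval_def, eval₂_eq_sum, Polynomial.sum] at hg
      simpa [ψ] using congrArg φ hg
    have h2 : ∀ k, ((z k * y ^ k : V) : FractionRing (S ⧸ P)) =
        ψ c / ψ (c * g.coeff j) * (ψ (g.coeff k) * φ s ^ k) := fun k ↦ by
      push_cast
      rw [hy]
      change ψ (c * g.coeff k) / ψ (c * g.coeff j) * _ = _
      rw [map_mul ψ c (g.coeff k)]; ring
    rw [AddSubmonoidClass.coe_finsetSum, Finset.sum_congr rfl fun k _ ↦ h2 k, ← Finset.mul_sum,
      h1, mul_zero, ZeroMemClass.coe_zero]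
  exact .of_sum_eq_zero (residue V) hz hj (by rw [hzj, map_one]; exact one_ne_zero) hzy

end IsPrimitiveExtension

/-! ### Flat epimorphisms and ideals of denominators -/

section Denominators

variable {A U : Type*} [CommRing A] [CommRing U] [Algebra A U]

variable (A) in
/-- The ideal `(A :_A u)` of all `a : A` such that `a • u` lies in the image of `A` in `U`. -/
def denominatorIdeal (u : U) : Ideal A :=
  (1 : Submodule A U).colon {u}

theorem mem_denominatorIdeal {u : U} {a : A} :
    a ∈ denominatorIdeal A u ↔ ∃ b, algebraMap A U b = a • u := by
  rw [denominatorIdeal, Submodule.mem_colon_singleton, Submodule.mem_one]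

theorem exists_sum_eq_one_of_map_eq_top {J : Ideal A} (hJ : J.map (algebraMap A U) = ⊤) :
    ∃ (k : ℕ) (c : Fin k → A) (y : Fin k → U), (∀ j, c j ∈ J) ∧ ∑ j, c j • y j = 1 := by
  have h1 : (1 : U) ∈ Submodule.span U (algebraMap A U '' J) :=
    ((Ideal.eq_top_iff_one _).mp hJ :)
  obtain ⟨k, y, g, hg⟩ := Submodule.mem_span_set'.mp h1
  choose c hc hcg using fun j ↦ (g j).2
  refine ⟨k, c, y, hc, ?_⟩
  rw [← hg]
  exact Finset.sum_congr rfl fun j _ ↦ by rw [Algebra.smul_def, hcg, smul_eq_mul, mul_comm]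

/-- For a finite family `x`, products of denominators of its members generate the unit ideal of `U`
and carry the whole family into `A`. Hence every linear relation among the `x i` is trivial in the
sense of the equational criterion for flatness. -/
theorem IsFlatEpimorphism.of_map_denominatorIdeal_eq_top
    (hinj : Function.Injective (algebraMap A U))
    (h : ∀ u : U, (denominatorIdeal A u).map (algebraMap A U) = ⊤) : IsFlatEpimorphism A U where
  flat := by
    refine Module.Flat.of_forall_isTrivialRelation fun {l f x} hfx ↦ ?_
    have hJ : (∏ i, denominatorIdeal A (x i)).map (algebraMap A U) = ⊤ := by
      change Ideal.mapHom (algebraMap A U) _ = ⊤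
      rw [map_prod, ← Ideal.one_eq_top]
      exact Finset.prod_eq_one fun i _ ↦ (h (x i)).trans Ideal.one_eq_top.symm
    obtain ⟨k, c, y, hc, hcy⟩ := exists_sum_eq_one_of_map_eq_top hJ
    have hcx (j : Fin k) (i : Fin l) : ∃ b, algebraMap A U b = c j • x i :=
      mem_denominatorIdeal.mp
        ((Ideal.prod_le_inf.trans (Finset.inf_le (Finset.mem_univ i))) (hc j))
    choose b hb using hcx
    refine ⟨k, fun i j ↦ b j i, y, fun i ↦ ?_, fun j ↦ hinj ?_⟩
    · calc x i = x i * ∑ j, c j • y j := by rw [hcy, mul_one]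
        _ = _ := by
          rw [Finset.mul_sum]
          exact Finset.sum_congr rfl fun j _ ↦ by
            rw [Algebra.smul_def (b j i), hb, mul_smul_comm, smul_mul_assoc]
    · calc algebraMap A U (∑ i, f i * b j i) = c j • ∑ i, f i • x i := by
            rw [map_sum, Finset.smul_sum]
            exact Finset.sum_congr rfl fun i _ ↦ by
              rw [map_mul, hb, smul_comm, Algebra.smul_def (f i)]
        _ = algebraMap A U 0 := by rw [hfx, smul_zero, map_zero]
  epi := by
    refine (Algebra.isEpi_iff_forall_one_tmul_eq A U).mpr fun x ↦ ?_
    obtain ⟨k, c, y, hc, hcy⟩ := exists_sum_eq_one_of_map_eq_top (h x)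
    choose b hb using fun j ↦ mem_denominatorIdeal.mp (hc j)
    have hbx (j : Fin k) : b j • y j = c j • (x * y j) := by
      rw [Algebra.smul_def, hb, smul_mul_assoc]
    calc (1 : U) ⊗ₜ[A] x = ∑ j, (c j • y j) ⊗ₜ[A] x := by rw [← TensorProduct.sum_tmul, hcy]
      _ = ∑ j, (b j • y j) ⊗ₜ[A] (1 : U) := Finset.sum_congr rfl fun j _ ↦ by
          rw [TensorProduct.smul_tmul, ← hb, Algebra.algebraMap_eq_smul_one,
            ← TensorProduct.smul_tmul]
      _ = x ⊗ₜ[A] (1 : U) := by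
          rw [← TensorProduct.sum_tmul, Finset.sum_congr rfl fun j _ ↦ hbx j]
          simp_rw [← mul_smul_comm]
          rw [← Finset.mul_sum, hcy, mul_one]

/-- Tensoring the exact sequence `0 → (A :_A u) → A → U / A`, whose last map is `a ↦ a • u`, with
the flat algebra `U` gives the claim, because `U ⊗ U / A = 0` for an epimorphism. -/
theorem IsFlatEpimorphism.map_denominatorIdeal_eq_top (h : IsFlatEpimorphism A U) (u : U) :
    (denominatorIdeal A u).map (algebraMap A U) = ⊤ := by
  have := h.flat
  let N : Submodule A U := 1
  let π : A →ₗ[A] U ⧸ N := LinearMap.toSpanSingleton A _ (N.mkQ u)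
  let J := denominatorIdeal A u
  have hexact : Function.Exact J.subtype π := by
    intro a
    rw [LinearMap.toSpanSingleton_apply, ← map_smul, Submodule.mkQ_apply,
      Submodule.Quotient.mk_eq_zero, Set.mem_range]
    refine (Submodule.mem_colon_singleton (N := N)).symm.trans ⟨fun ha ↦ ⟨⟨a, ha⟩, rfl⟩, ?_⟩
    rintro ⟨b, rfl⟩
    exact b.2
  have hzero : π.lTensor U ((1 : U) ⊗ₜ[A] (1 : A)) = 0 := by
    have h1 : N.mkQ 1 = 0 :=
      (Submodule.Quotient.mk_eq_zero _).mpr (Submodule.mem_one.mpr ⟨1, map_one _⟩)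
    calc π.lTensor U ((1 : U) ⊗ₜ[A] (1 : A)) = N.mkQ.lTensor U ((1 : U) ⊗ₜ[A] u) := by
          simp [π]
      _ = N.mkQ.lTensor U (u ⊗ₜ[A] (1 : U)) := by
          rw [(Algebra.isEpi_iff_forall_one_tmul_eq A U).mp h.epi]
      _ = 0 := by rw [LinearMap.lTensor_tmul, h1, TensorProduct.tmul_zero]
  obtain ⟨z, hz⟩ := (Module.Flat.lTensor_exact U hexact _).mp hzero
  have hmem (z : U ⊗[A] J) :
      TensorProduct.rid A U (J.subtype.lTensor U z) ∈ J.map (algebraMap A U) := by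
    induction z with
    | zero => simp
    | tmul x a =>
      rw [LinearMap.lTensor_tmul, TensorProduct.rid_tmul, Algebra.smul_def]
      exact Ideal.mul_mem_right _ _ (Ideal.mem_map_of_mem _ a.2)
    | add x y hx hy => rw [map_add, map_add]; exact add_mem hx hy
  rw [Ideal.eq_top_iff_one]
  have := hmem z
  rwa [hz, TensorProduct.rid_tmul, one_smul] at this

/-- Over a ring integrally closed in `U`, all coefficients of a polynomial killing `u` lie in
`(A :_A u) U`. -/
theorem algebraMap_coeff_mem_map_denominatorIdeal [IsIntegrallyClosedIn A U] {u : U} {f : A[X]}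
    (hf : aeval u f = 0) (i : ℕ) :
    algebraMap A U (f.coeff i) ∈ (denominatorIdeal A u).map (algebraMap A U) := by
  obtain ⟨n, hn⟩ : ∃ n, f.natDegree ≤ n := ⟨_, le_rfl⟩
  induction n generalizing f i with
  | zero =>
    rw [nonpos_iff_eq_zero] at hn
    rw [eq_C_of_natDegree_eq_zero hn, aeval_C] at hf
    rw [eq_C_of_natDegree_eq_zero hn, coeff_C]
    split_ifs
    · rw [hf]; exact zero_mem _
    · rw [map_zero]; exact zero_mem _
  | succ n ih =>
    rcases hn.lt_or_eq with hn | hn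
    · exact ih hf i (by omega)
    set a := f.leadingCoeff with ha
    obtain ⟨b, hb⟩ := IsIntegrallyClosedIn.algebraMap_eq_of_integral
      (isIntegral_leadingCoeff_smul f u hf)
    have haJ : algebraMap A U a ∈ (denominatorIdeal A u).map (algebraMap A U) :=
      Ideal.mem_map_of_mem _ (mem_denominatorIdeal.mpr ⟨b, hb⟩)
    have hbJ : algebraMap A U b ∈ (denominatorIdeal A u).map (algebraMap A U) := by
      rw [hb, Algebra.smul_def]; exact Ideal.mul_mem_right _ _ haJ
    -- Since `a * u = b`, the leading term `a * X ^ (n + 1)` may be replaced by `b * X ^ n`.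
    have hfg : f.eraseLead + C a * X ^ (n + 1) = f := by
      rw [ha, ← hn, eraseLead_add_C_mul_X_pow]
    have hg : aeval u (f.eraseLead + C b * X ^ n) = 0 := by
      rw [← hfg] at hf
      rw [← hf]
      simp only [map_add, map_mul, aeval_C, map_pow, aeval_X, hb, Algebra.smul_def]
      ring
    have hle : (f.eraseLead + C b * X ^ n).natDegree ≤ n :=
      natDegree_add_le_of_degree_le (f.eraseLead_natDegree_le.trans (by omega))
        (natDegree_C_mul_X_pow_le b n)
    have hi := ih hg i hle
    rw [coeff_add, map_add, coeff_C_mul_X_pow] at hi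
    rw [← hfg, coeff_add, map_add, coeff_C_mul_X_pow]
    refine add_mem ?_ (by split_ifs; exacts [haJ, by rw [map_zero]; exact zero_mem _])
    refine (Submodule.add_mem_iff_left _ ?_).mp hi
    split_ifs
    exacts [hbJ, by rw [map_zero]; exact zero_mem _]

end Denominators

/-! ### Prüfer, quasi-Prüfer and primitive extensions -/

theorem IsPruferExtension.isPrimitiveExtension {A S : Type*} [CommRing A] [CommRing S]
    [Algebra A S] (h : IsPruferExtension A S) : IsPrimitiveExtension A S := by
  intro s p hp
  let U := Algebra.adjoin A {s}
  let u : U := ⟨s, Algebra.self_mem_adjoin_singleton A s⟩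
  have hsurj : Function.Surjective (aeval u : A[X] →ₐ[A] U) := by
    rintro ⟨w, hw⟩
    obtain ⟨g, rfl⟩ := (Algebra.adjoin_singleton_eq_range_aeval A s).le hw
    exact ⟨g, Subtype.ext (aeval_algebraMap_apply S u g).symm⟩
  have htop := (h U).map_denominatorIdeal_eq_top u
  have hmap : ((denominatorIdeal A u).map C).map (aeval u : A[X] →ₐ[A] U).toRingHom = ⊤ := by
    rw [Ideal.map_map, ← htop]
    congr 1
    ext a
    simp
  obtain ⟨g, hg, hgu⟩ := (Ideal.mem_map_iff_of_surjective _ hsurj).mp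
    (hmap ▸ Submodule.mem_top : (1 : U) ∈ _)
  have hgs : aeval s g = 1 := by
    rw [show s = algebraMap U S u from rfl, aeval_algebraMap_apply]
    exact (congrArg (algebraMap U S) hgu).trans (map_one _)
  -- The constant coefficient `c` of `g` lies in `(A :_A s)`; both `1 - g` and `c * X - c * s`
  -- vanish at `s`, and `p` cannot contain both `1 - c` and `c`.
  by_cases hc : g.coeff 0 ∈ p
  · refine ⟨1 - g, by rw [map_sub, hgs, map_one, sub_self], 0, fun h1 ↦ hp.one_notMem ?_⟩
    rw [coeff_sub, coeff_one_zero] at h1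
    simpa using add_mem h1 hc
  · obtain ⟨b, hb⟩ := mem_denominatorIdeal.mp (Ideal.mem_map_C_iff.mp hg 0)
    refine ⟨C (g.coeff 0) * X - C b, ?_, 1, by simpa [coeff_C] using hc⟩
    have := congrArg (algebraMap U S) hb
    rw [← IsScalarTower.algebraMap_apply A U S, Algebra.smul_def, map_mul,
      ← IsScalarTower.algebraMap_apply A U S] at this
    rw [map_sub, map_mul, aeval_C, aeval_C, aeval_X, this]
    exact sub_self _

theorem IsPrimitiveExtension.isPruferExtension {A S : Type*} [CommRing A] [CommRing S]
    [Algebra A S] [IsIntegrallyClosedIn A S] (h : IsPrimitiveExtension A S) :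
    IsPruferExtension A S := by
  obtain ⟨hinj, hint⟩ := isIntegrallyClosedIn_iff.mp ‹IsIntegrallyClosedIn A S›
  intro U
  have hUS : Function.Injective (algebraMap U S) := Subtype.val_injective
  have hU : IsIntegrallyClosedIn A U := by
    refine isIntegrallyClosedIn_iff.mpr ⟨?_, fun {x} hx ↦ ?_⟩
    · rw [IsScalarTower.algebraMap_eq A U S, RingHom.coe_comp] at hinj
      exact Function.Injective.of_comp hinj
    · obtain ⟨y, hy⟩ := hint (hx.algebraMap (B := S))
      exact ⟨y, hUS (by rw [← IsScalarTower.algebraMap_apply, hy])⟩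
  refine .of_map_denominatorIdeal_eq_top hU.algebraMap_injective fun u ↦ ?_
  by_contra hne
  obtain ⟨M, hM, hle⟩ := Ideal.exists_le_maximal _ hne
  obtain ⟨f, hf, i, hi⟩ := h.bot_of_injective hUS u (M.comap (algebraMap A U)) inferInstance
  exact hi (hle (algebraMap_coeff_mem_map_denominatorIdeal hf i))

/-- Pass through the integral closure `R'` of `R` in `S`: `R → R'` is primitive, being integral, and
`R' → S` is primitive if and only if it is Prüfer. -/
theorem isQuasiPruferExtension_iff_isPrimitiveExtension {R S : Type*} [CommRing R] [CommRing S]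
    [Algebra R S] : IsQuasiPruferExtension R S ↔ IsPrimitiveExtension R S :=
  ⟨fun h ↦ .trans (T := integralClosure R S) .of_isIntegral h.isPrimitiveExtension,
    fun h ↦ h.top.isPruferExtension⟩

/-- The tower `R ⊆ T ⊆ S` is given by injective algebra maps; the compositum `R'T` (with `R'` the
integral closure of `R` in `S`) is the subring of `S` generated by `R'` and the image of `T`. -/
theorem corollary3p3 {R T S : Type*} [CommRing R] [CommRing T] [CommRing S]
    [Algebra R T] [Algebra T S] [Algebra R S] [IsScalarTower R T S]
    (hRT : Function.Injective (algebraMap R T)) (hTS : Function.Injective (algebraMap T S)) :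
    (IsQuasiPruferExtension R S ↔
      IsQuasiPruferExtension R T ∧ IsQuasiPruferExtension T S) ∧
    (IsQuasiPruferExtension R T ↔
      IsQuasiPruferExtension R
        ↥(integralClosure R S ⊔ (IsScalarTower.toAlgHom R T S).range)) := by
  simp only [isQuasiPruferExtension_iff_isPrimitiveExtension]
  refine ⟨⟨fun h ↦ ⟨h.bot_of_injective hTS, h.top⟩, fun h ↦ h.1.trans h.2⟩, ?_⟩
  set B := integralClosure R S ⊔ (IsScalarTower.toAlgHom R T S).range with hB
  let ι : T →ₐ[R] B := (IsScalarTower.toAlgHom R T S).codRestrict B fun t ↦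
    (le_sup_right : _ ≤ B) ⟨t, rfl⟩
  let : Algebra T B := ι.toRingHom.toAlgebra
  have : IsScalarTower R T B := .of_algebraMap_eq fun r ↦ (ι.commutes r).symm
  have : IsScalarTower T B S := .of_algebraMap_eq fun _ ↦ rfl
  have hBS : Function.Injective (algebraMap B S) := Subtype.val_injective
  have hTB : Function.Injective (algebraMap T B) := by
    rw [IsScalarTower.algebraMap_eq T B S, RingHom.coe_comp] at hTS
    exact Function.Injective.of_comp hTS
  have hle : B ≤ (integralClosure T S).restrictScalars R :=
    sup_le (fun x hx ↦ IsIntegral.tower_top hx) (by rintro _ ⟨t, rfl⟩; exact isIntegral_algebraMap)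
  have : Algebra.IsIntegral T B :=
    ⟨fun b ↦ (isIntegral_algebraMap_iff hBS).mp (hle b.2)⟩
  exact ⟨fun h ↦ h.trans .of_isIntegral, fun h ↦ h.bot_of_injective hTB⟩
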